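/- Let $X$ be a Tychonoff space, and let $C_\Gamma(X)$ be the set of all continuous functions $f:X\to\mathbb R$ equipped with the graph topology, i.e. the topology generated by the sets $F_U=\{f : \{(x,f(x)) : x\in X\}\subseteq U\}$, where $U$ ranges over the open subsets of $X\times\mathbb R$. Then the following are equivalent: 1. $C_\Gamma(X)$ is completely metrizable; 2. $C_\Gamma(X)$ is Čech complete, i.e. it is a $G_\delta$ subspace of some Hausdorff compactification of it; 3. $C_\Gamma(X)$ is sieve complete, i.e. it is the image of a Čech complete space under a continuous open map; 4. $C_\Gamma(X)$ is hereditarily Baire, i.e. each of its closed subspaces is a Baire space (countable intersections of dense open subsets are dense); 5. $X$ is countably compact. -/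

import Mathlib

open Set Topology

universe u v

/-- The space `C_Γ(X, Y)`: the set of continuous maps `X → Y`. This is a type synonym of `C(X, Y)`,
so that it does not carry the compact-open topology; its topology is the graph topology below. -/
def GraphSpace (X : Type u) (Y : Type v) [TopologicalSpace X] [TopologicalSpace Y] :
    Type (max u v) :=
  C(X, Y)

/-- `F_U`: the continuous maps whose graph is contained in `U ⊆ X × Y`. -/
def graphNhd {X : Type u} {Y : Type v} [TopologicalSpace X] [TopologicalSpace Y]
    (U : Set (X × Y)) : Set (GraphSpace X Y) :=
  {f : C(X, Y) | ∀ x : X, (x, f x) ∈ U}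

/-- The graph topology is generated by the sets `F_U`, for `U` open in `X × Y`.
(Whether `U = ∅` is admitted is immaterial: `F_∅` is empty, or everything if `X` is empty.) -/
instance GraphSpace.instTopologicalSpace (X : Type u) (Y : Type v)
    [TopologicalSpace X] [TopologicalSpace Y] : TopologicalSpace (GraphSpace X Y) :=
  TopologicalSpace.generateFrom {S | ∃ U : Set (X × Y), IsOpen U ∧ S = graphNhd U}

/-- A space is Čech complete if it is a `G_δ` subspace of some Hausdorff compactification.
(Up to homeomorphism every Hausdorff compactification of `Z` lives in the universe of `Z`.) -/
def IsCechComplete (Z : Type u) [TopologicalSpace Z] : Prop :=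
  ∃ (K : Type u) (_ : TopologicalSpace K) (_ : CompactSpace K) (_ : T2Space K) (e : Z → K),
    IsDenseEmbedding e ∧ IsGδ (range e)

/-- A space is sieve complete if it is a continuous open image of a Čech complete space. -/
def IsSieveComplete (Z : Type u) [TopologicalSpace Z] : Prop :=
  ∃ (W : Type u) (_ : TopologicalSpace W) (f : W → Z),
    IsCechComplete W ∧ Continuous f ∧ IsOpenMap f ∧ Function.Surjective f

/-- A space is hereditarily Baire if each of its closed subspaces is a Baire space. -/
def IsHereditarilyBaire (Z : Type u) [TopologicalSpace Z] : Prop :=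
  ∀ F : Set Z, IsClosed F → BaireSpace F

/-!
Countable compactness of `X` is what makes the graph topology on `C(X, ℝ)` coincide with the
topology of uniform convergence: if `U` is an open neighbourhood of the graph of `f`, the open sets
of those `x` near which the `1 / (n + 1)`-tube around the graph stays in `U` increase to `X`, so one
of them is all of `X` (`exists_tube_subset`). All continuous functions being bounded, the graph space
is then homeomorphic to the Banach space of bounded continuous functions.

A completely metrizable space `Z` is a `G_δ` in its Stone-Čech compactification: it consists of the
points which, for every `n`, have a neighbourhood whose trace on `Z` has diameter at most
`1 / (n + 1)`, because the trace on `Z` of the neighbourhood filter of such a point is Cauchy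
(`isCechComplete_of_isCompletelyMetrizableSpace`). A Čech complete space is trivially sieve complete.
A closed subspace of a sieve complete space is an open image of a closed subspace of a Čech complete
space, that is, of a `G_δ` in a compact Hausdorff space, so it is Baire
(`IsSieveComplete.isHereditarilyBaire`).

Finally, if `X` is not countably compact, it contains a sequence of distinct points `x n` all of whose
subsets are closed. The functions vanishing at all but finitely many `x n` form a closed subspace of
the graph space, which is the union of the closed sets `{f | ∀ n ≥ m, f (x n) = 0}`. These have empty
interior, since a small bump at `x m` leads out of them, so the subspace is not Baire
(`countablyCompactSpace_of_isHereditarilyBaire`).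
-/

open Filter

/-! ### The graph topology -/

namespace GraphSpace

variable {X : Type u} {Y : Type v} [TopologicalSpace X] [TopologicalSpace Y]

instance instFunLike : FunLike (GraphSpace X Y) X Y :=
  inferInstanceAs (FunLike C(X, Y) X Y)

instance instContinuousMapClass : ContinuousMapClass (GraphSpace X Y) X Y :=
  inferInstanceAs (ContinuousMapClass C(X, Y) X Y)

/-- A continuous map, regarded as a point of the graph space. -/
def of (f : C(X, Y)) : GraphSpace X Y := f

theorem mem_graphNhd {f : GraphSpace X Y} {U : Set (X × Y)} :
    f ∈ graphNhd U ↔ ∀ x, (x, f x) ∈ U := Iff.rfl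

theorem isOpen_graphNhd {U : Set (X × Y)} (hU : IsOpen U) : IsOpen (graphNhd U) :=
  TopologicalSpace.isOpen_generateFrom_of_mem ⟨U, hU, rfl⟩

theorem isTopologicalBasis_graphNhd :
    TopologicalSpace.IsTopologicalBasis
      {S : Set (GraphSpace X Y) | ∃ U : Set (X × Y), IsOpen U ∧ S = graphNhd U} where
  exists_subset_inter := by
    rintro _ ⟨U, hU, rfl⟩ _ ⟨V, hV, rfl⟩ f ⟨hfU, hfV⟩
    exact ⟨graphNhd (U ∩ V), ⟨U ∩ V, hU.inter hV, rfl⟩, fun x ↦ ⟨hfU x, hfV x⟩,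
      fun g hg ↦ ⟨fun x ↦ (hg x).1, fun x ↦ (hg x).2⟩⟩
  sUnion_eq := eq_univ_of_forall fun f ↦ ⟨graphNhd univ, ⟨univ, isOpen_univ, rfl⟩, fun _ ↦ trivial⟩
  eq_generateFrom := rfl

theorem mem_nhds_iff {f : GraphSpace X Y} {S : Set (GraphSpace X Y)} :
    S ∈ 𝓝 f ↔ ∃ U : Set (X × Y), IsOpen U ∧ f ∈ graphNhd U ∧ graphNhd U ⊆ S := by
  rw [isTopologicalBasis_graphNhd.mem_nhds_iff]
  constructor
  · rintro ⟨_, ⟨U, hU, rfl⟩, hf, hS⟩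
    exact ⟨U, hU, hf, hS⟩
  · rintro ⟨U, hU, hf, hS⟩
    exact ⟨_, ⟨U, hU, rfl⟩, hf, hS⟩

/-! ### Countably compact domains -/

/-- The open tube of radius `ε` around the graph of `f`. -/
def tube (f : GraphSpace X ℝ) (ε : ℝ) : Set (X × ℝ) := {p | |p.2 - f p.1| < ε}

theorem isOpen_tube (f : GraphSpace X ℝ) (ε : ℝ) : IsOpen (tube f ε) := by
  have hf : Continuous f := map_continuous f
  exact isOpen_lt (by fun_prop) continuous_const

theorem exists_tube_subset [CountablyCompactSpace X] {U : Set (X × ℝ)} (hU : IsOpen U)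
    {f : GraphSpace X ℝ} (hf : f ∈ graphNhd U) : ∃ ε > 0, tube f ε ⊆ U := by
  have hfc : Continuous f := map_continuous f
  let A : ℕ → Set X := fun n ↦ {x | ∀ t, |t - f x| < 1 / ((n : ℝ) + 1) → (x, t) ∈ U}
  have hA : Monotone A := fun m n hmn x hx t ht ↦
    hx t (ht.trans_le (one_div_le_one_div_of_le (by positivity) (by gcongr)))
  have hcover : (univ : Set X) ⊆ ⋃ n, interior (A n) := by
    intro x _
    obtain ⟨V, hV, W, hW, hVW⟩ := mem_nhds_prod_iff.1 (hU.mem_nhds (hf x))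
    obtain ⟨δ, hδ, hball⟩ := Metric.mem_nhds_iff.1 hW
    obtain ⟨n, hn⟩ := exists_nat_one_div_lt (half_pos hδ)
    refine mem_iUnion.2 ⟨n, mem_interior_iff_mem_nhds.2 ?_⟩
    filter_upwards [hV, hfc.continuousAt (Metric.ball_mem_nhds (f x) (half_pos hδ))] with y hy hfy
    intro t ht
    refine hVW ⟨hy, hball ?_⟩
    have h1 : dist t (f y) < δ / 2 := by rw [Real.dist_eq]; exact ht.trans hn
    have h2 : dist (f y) (f x) < δ / 2 := hfy
    exact (dist_triangle t (f y) (f x)).trans_lt (by linarith)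
  obtain ⟨n, hn⟩ := CountablyCompactSpace.isCountablyCompact_univ.elim_directed_cover
    (fun n ↦ interior (A n)) (fun n ↦ isOpen_interior) hcover
    (directed_of_isDirected_le fun m n hmn ↦ interior_mono (hA hmn))
  exact ⟨1 / ((n : ℝ) + 1), by positivity,
    fun p hp ↦ interior_subset (hn (mem_univ p.1)) p.2 hp⟩

theorem isBounded_range [CountablyCompactSpace X] (f : GraphSpace X ℝ) :
    Bornology.IsBounded (range f) := by
  rw [← image_univ]
  exact (CountablyCompactSpace.isCountablyCompact_univ.image (map_continuous f)).isCompact.isBounded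

open scoped BoundedContinuousFunction

theorem isInducing_of_boundedContinuousFunction [CountablyCompactSpace X] :
    IsInducing fun f : X →ᵇ ℝ ↦ of f.toContinuousMap := by
  refine isInducing_iff_nhds.2 fun f ↦ Filter.ext fun S ↦ ?_
  rw [mem_comap]
  constructor
  · intro hS
    obtain ⟨ε, hε, hball⟩ := Metric.mem_nhds_iff.1 hS
    refine ⟨graphNhd (tube (of f.toContinuousMap) (ε / 2)),
      (isOpen_graphNhd (isOpen_tube _ _)).mem_nhds fun x ↦ ?_, fun g hg ↦ hball ?_⟩
    · change |f x - f x| < ε / 2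
      simpa using hε
    · refine ((BoundedContinuousFunction.dist_le (half_pos hε).le).2 fun x ↦ ?_).trans_lt
        (half_lt_self hε)
      rw [Real.dist_eq]
      exact (hg x).le
  · rintro ⟨T, hT, hTS⟩
    obtain ⟨U, hU, hfU, hUT⟩ := mem_nhds_iff.1 hT
    obtain ⟨ε, hε, htube⟩ := exists_tube_subset hU hfU
    refine mem_of_superset (Metric.ball_mem_nhds f hε) fun g hg ↦ hTS (hUT fun x ↦ htube ?_)
    have : dist (g x) (f x) < ε := (BoundedContinuousFunction.dist_coe_le_dist x).trans_lt hg
    rwa [Real.dist_eq] at this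

theorem isCompletelyMetrizableSpace [CountablyCompactSpace X] :
    TopologicalSpace.IsCompletelyMetrizableSpace (GraphSpace X ℝ) := by
  let e : (X →ᵇ ℝ) ≃ GraphSpace X ℝ :=
    { toFun := fun f ↦ of f.toContinuousMap
      invFun := fun f ↦ ⟨⟨f, map_continuous f⟩, Metric.isBounded_range_iff.1 (isBounded_range f)⟩
      left_inv := fun _ ↦ rfl
      right_inv := fun _ ↦ rfl }
  exact (e.toHomeomorphOfIsInducing
    isInducing_of_boundedContinuousFunction).symm.isClosedEmbedding.IsCompletelyMetrizableSpace

end GraphSpace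

/-! ### Complete metrizability, Čech completeness and sieve completeness -/

/-- The embedding into the Stone-Čech compactification witnesses Čech completeness. -/
theorem isCechComplete_of_isCompletelyMetrizableSpace (Z : Type u) [TopologicalSpace Z]
    [TopologicalSpace.IsCompletelyMetrizableSpace Z] : IsCechComplete Z := by
  let := TopologicalSpace.upgradeIsCompletelyMetrizable Z
  have he : IsDenseEmbedding (stoneCechUnit : Z → StoneCech Z) := isDenseEmbedding_stoneCechUnit
  refine ⟨StoneCech Z, inferInstance, inferInstance, inferInstance, stoneCechUnit, he, ?_⟩
  let O : ℕ → Set (StoneCech Z) := fun n ↦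
    ⋃₀ {V | IsOpen V ∧ ∀ x y : Z, stoneCechUnit x ∈ V → stoneCechUnit y ∈ V →
      dist x y ≤ 1 / ((n : ℝ) + 1)}
  have hO : range (stoneCechUnit : Z → StoneCech Z) = ⋂ n, O n := by
    apply Subset.antisymm
    · rintro _ ⟨z, rfl⟩
      refine mem_iInter.2 fun n ↦ ?_
      obtain ⟨V, hV, hVball⟩ := he.isInducing.isOpen_iff.1
        (Metric.isOpen_ball (x := z) (ε := 1 / ((n : ℝ) + 1) / 2))
      have hmem (x : Z) : stoneCechUnit x ∈ V ↔ dist x z < 1 / ((n : ℝ) + 1) / 2 := by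
        rw [← mem_preimage, hVball, Metric.mem_ball]
      refine ⟨V, ⟨hV, fun x y hx hy ↦ ?_⟩, (hmem z).2 (by rw [dist_self]; positivity)⟩
      have := dist_triangle_right x y z
      linarith [(hmem x).1 hx, (hmem y).1 hy]
    · intro p hp
      have : NeBot (comap stoneCechUnit (𝓝 p)) := he.isDenseInducing.comap_nhds_neBot p
      have hc : Cauchy (comap (stoneCechUnit : Z → StoneCech Z) (𝓝 p)) := by
        refine Metric.cauchy_iff.2 ⟨this, fun ε hε ↦ ?_⟩
        obtain ⟨n, hn⟩ := exists_nat_one_div_lt hε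
        obtain ⟨V, ⟨hV, hdist⟩, hpV⟩ := mem_iInter.1 hp n
        exact ⟨stoneCechUnit ⁻¹' V, preimage_mem_comap (hV.mem_nhds hpV),
          fun x hx y hy ↦ (hdist x y hx hy).trans_lt hn⟩
      obtain ⟨z, hz⟩ := CompleteSpace.complete hc
      refine ⟨z, tendsto_nhds_unique (f := stoneCechUnit)
        (l := comap (stoneCechUnit : Z → StoneCech Z) (𝓝 p)) ?_ tendsto_comap⟩
      exact (continuous_stoneCechUnit.tendsto z).mono_left hz
  rw [hO]
  exact .iInter_of_isOpen fun n ↦ isOpen_sUnion fun V hV ↦ hV.1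

theorem IsCechComplete.isSieveComplete {Z : Type u} [TopologicalSpace Z] (h : IsCechComplete Z) :
    IsSieveComplete Z :=
  ⟨Z, inferInstance, id, h, continuous_id, IsOpenMap.id, Function.surjective_id⟩

theorem IsCechComplete.isHereditarilyBaire {Z : Type u} [TopologicalSpace Z]
    (h : IsCechComplete Z) : IsHereditarilyBaire Z := by
  obtain ⟨K, _, _, _, e, he, hG⟩ := h
  intro F hF
  -- `F` is identified with a `G_δ` of the closure of its image, which is compact Hausdorff.
  let C : Set K := closure (e '' F)
  have : CompactSpace C := isCompact_iff_compactSpace.1 isClosed_closure.isCompact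
  let i : F → C := fun z ↦ ⟨e z, subset_closure (mem_image_of_mem e z.2)⟩
  have hi : IsEmbedding i :=
    (he.isEmbedding.comp IsEmbedding.subtypeVal).codRestrict _
      fun z : F ↦ subset_closure (mem_image_of_mem e z.2)
  have hrange : range i = (Subtype.val : C → K) ⁻¹' range e := by
    ext ⟨k, hk⟩
    constructor
    · rintro ⟨z, hz⟩
      exact ⟨z, congrArg Subtype.val hz⟩
    · rintro ⟨z, rfl⟩
      have hz : z ∈ F := by
        rw [← hF.closure_eq, he.isInducing.closure_eq_preimage_closure_image]
        exact hk
      exact ⟨⟨z, hz⟩, rfl⟩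
  have hGi : IsGδ (range i) := hrange ▸ hG.preimage continuous_subtype_val
  have : BaireSpace (range i) := hGi.baireSpace_of_t2Space_locallyCompactSpace
  exact hi.toHomeomorph.symm.baireSpace

theorem IsSieveComplete.isHereditarilyBaire {Z : Type u} [TopologicalSpace Z]
    (h : IsSieveComplete Z) : IsHereditarilyBaire Z := by
  obtain ⟨W, _, f, hW, hfc, hfo, hfs⟩ := h
  intro F hF
  have : BaireSpace (f ⁻¹' F) := hW.isHereditarilyBaire _ (hF.preimage hfc)
  have hq : IsOpenQuotientMap (F.restrictPreimage f) :=
    ⟨F.restrictPreimage_surjective hfs, hfc.restrictPreimage, hfo.restrictPreimage F⟩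
  exact hq.baireSpace

/-! ### Domains that are not countably compact -/

theorem exists_injective_seq_isClosed_image {X : Type u} [TopologicalSpace X] [T1Space X]
    (h : ¬ CountablyCompactSpace X) :
    ∃ x : ℕ → X, Function.Injective x ∧ ∀ s : Set ℕ, IsClosed (x '' s) := by
  rw [← isCountablyCompact_univ_iff, isCountablyCompact_iff_infinite_subset_has_accPt] at h
  push Not at h
  obtain ⟨B, -, hB, hacc⟩ := h
  refine ⟨fun n ↦ hB.natEmbedding B n,
    Subtype.val_injective.comp (hB.natEmbedding B).injective, fun s ↦ ?_⟩
  refine isClosed_iff_accPt.2 fun a ha ↦ (hacc a (mem_univ a) (ha.mono ?_)).elim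
  rw [principal_mono]
  rintro _ ⟨n, -, rfl⟩
  exact (hB.natEmbedding B n).2

/-- Adding a small bump: within a given neighbourhood in the graph topology, a function can be
modified at a point without changing it away from that point. -/
theorem GraphSpace.exists_mem_graphNhd_ne {X : Type u} [TopologicalSpace X]
    [CompletelyRegularSpace X] {U : Set (X × ℝ)} (hU : IsOpen U) {f : GraphSpace X ℝ}
    (hf : f ∈ graphNhd U) {p : X} {V : Set X} (hV : V ∈ 𝓝 p) :
    ∃ g ∈ graphNhd U, g p ≠ f p ∧ ∀ y ∉ V, g y = f y := by
  have hfc : Continuous f := map_continuous f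
  obtain ⟨N, hN, T, hT, hNT⟩ := mem_nhds_prod_iff.1 (hU.mem_nhds (hf p))
  obtain ⟨ε, hε, hball⟩ := Metric.mem_nhds_iff.1 hT
  have hnhds : V ∩ N ∩ f ⁻¹' Metric.ball (f p) (ε / 2) ∈ 𝓝 p :=
    inter_mem (inter_mem hV hN) (hfc.continuousAt (Metric.ball_mem_nhds _ (half_pos hε)))
  obtain ⟨G, hGsub, hG, hpG⟩ := _root_.mem_nhds_iff.1 hnhds
  obtain ⟨φ, hφ, hφp, hφG⟩ := completelyRegularSpace_iff_isOpen.1 ‹_› p G hG hpG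
  -- `φ` is `0` at `p` and `1` outside `G`, so `1 - φ` is the bump.
  let g : GraphSpace X ℝ := GraphSpace.of ⟨fun y ↦ f y + ε / 2 * (1 - φ y), by fun_prop⟩
  have hg (y : X) : g y = f y + ε / 2 * (1 - φ y) := rfl
  have hgG {y : X} (hy : y ∉ G) : g y = f y := by
    rw [hg, show φ y = 1 from hφG hy]
    simp
  refine ⟨g, fun y ↦ ?_, ?_, fun y hy ↦ hgG fun hyG ↦ hy (hGsub hyG).1.1⟩
  · by_cases hy : y ∈ G
    · refine hNT ⟨(hGsub hy).1.2, hball ?_⟩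
      have h1 : |f y - f p| < ε / 2 := (hGsub hy).2
      have h2 : ε / 2 * (1 - φ y) ≤ ε / 2 :=
        mul_le_of_le_one_right (half_pos hε).le (by linarith [(φ y).2.1])
      have h3 : 0 ≤ ε / 2 * (1 - φ y) :=
        mul_nonneg (half_pos hε).le (by linarith [(φ y).2.2])
      rw [abs_lt] at h1
      change |g y - f p| < ε
      rw [hg, abs_lt]
      constructor <;> linarith
    · change (y, g y) ∈ U
      rw [hgG hy]
      exact hf y
  · rw [hg, hφp]
    simp [hε.ne']

theorem GraphSpace.isClosed_setOf_apply_eq {X : Type u} {Y : Type v} [TopologicalSpace X]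
    [TopologicalSpace Y] [T1Space Y] [T1Space X] (x : X) (c : Y) :
    IsClosed {f : GraphSpace X Y | f x = c} := by
  have hK : IsClosed ({x} ×ˢ {c} : Set (X × Y)) := isClosed_singleton.prod isClosed_singleton
  convert! (isOpen_graphNhd hK.isOpen_compl).isClosed_compl using 1
  ext f
  simp [mem_graphNhd]

/-- The functions vanishing at all but finitely many terms of a sequence with closed image sets
form a closed set: if `f` does not vanish at infinitely many terms, then the functions whose graph
avoids the zeros over these terms are a neighbourhood of `f`. -/
theorem GraphSpace.isClosed_setOf_eventually_eq_zero {X : Type u} [TopologicalSpace X] {x : ℕ → X}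
    (hx : ∀ s : Set ℕ, IsClosed (x '' s)) :
    IsClosed {f : GraphSpace X ℝ | ∀ᶠ n in atTop, f (x n) = 0} := by
  refine isOpen_compl_iff.1 (isOpen_iff_mem_nhds.2 fun f hf ↦ mem_nhds_iff.2 ?_)
  have hK : IsClosed ((x '' {n | f (x n) ≠ 0}) ×ˢ ({0} : Set ℝ)) := (hx _).prod isClosed_singleton
  refine ⟨_, hK.isOpen_compl, ?_, fun g hg hg0 ↦ hf ?_⟩
  · rintro y ⟨⟨n, hn, rfl⟩, h0⟩
    exact hn h0
  · filter_upwards [hg0] with n hn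
    by_contra hne
    exact hg (x n) ⟨⟨n, hne, rfl⟩, hn⟩

theorem countablyCompactSpace_of_isHereditarilyBaire {X : Type u} [TopologicalSpace X]
    [T35Space X] (h : IsHereditarilyBaire (GraphSpace X ℝ)) : CountablyCompactSpace X := by
  by_contra hX
  obtain ⟨x, hinj, hx⟩ := exists_injective_seq_isClosed_image hX
  let F : Set (GraphSpace X ℝ) := {f | ∀ᶠ n in atTop, f (x n) = 0}
  have : BaireSpace F := h F (GraphSpace.isClosed_setOf_eventually_eq_zero hx)
  have : Nonempty F := ⟨⟨GraphSpace.of 0, Eventually.of_forall fun _ ↦ rfl⟩⟩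
  let A : ℕ → Set F := fun m ↦ {f | ∀ n ≥ m, f.1 (x n) = 0}
  have hA (m : ℕ) : IsClosed (A m) := by
    have : A m = ⋂ n ≥ m, Subtype.val ⁻¹' {f : GraphSpace X ℝ | f (x n) = 0} := by
      ext f
      simp [A]
    rw [this]
    exact isClosed_biInter fun n _ ↦
      (GraphSpace.isClosed_setOf_apply_eq (x n) 0).preimage continuous_subtype_val
  obtain ⟨m, f, hf⟩ := nonempty_interior_of_iUnion_of_closed hA
    (eq_univ_of_forall fun f ↦ mem_iUnion.2 (eventually_atTop.1 f.2))
  obtain ⟨T, hT, hTA⟩ := mem_nhds_subtype F f _ |>.1 (mem_interior_iff_mem_nhds.1 hf)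
  obtain ⟨U, hU, hfU, hUT⟩ := GraphSpace.mem_nhds_iff.1 hT
  -- A neighbourhood of `x m` missing the other terms of the sequence.
  have hV : (x '' {m}ᶜ)ᶜ ∈ 𝓝 (x m) :=
    (hx _).isOpen_compl.mem_nhds (by simp [hinj.eq_iff])
  obtain ⟨g, hgU, hgm, hgV⟩ := GraphSpace.exists_mem_graphNhd_ne hU hfU hV
  have hgF : g ∈ F := by
    filter_upwards [f.2, eventually_ne_atTop m] with n hn hnm
    rw [hgV (x n) (not_not.2 ⟨n, hnm, rfl⟩), hn]
  have hgA : (⟨g, hgF⟩ : F) ∈ A m := hTA (hUT hgU)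
  exact hgm ((hgA m le_rfl).trans (interior_subset hf m le_rfl).symm)

theorem theorem2p1 (X : Type u) [TopologicalSpace X] [T35Space X] :
    List.TFAE
      [TopologicalSpace.IsCompletelyMetrizableSpace (GraphSpace X ℝ),
       IsCechComplete (GraphSpace X ℝ),
       IsSieveComplete (GraphSpace X ℝ),
       IsHereditarilyBaire (GraphSpace X ℝ),
       CountablyCompactSpace X] := by
  tfae_have 1 → 2 := fun _ ↦ isCechComplete_of_isCompletelyMetrizableSpace _
  tfae_have 2 → 3 := IsCechComplete.isSieveComplete
  tfae_have 3 → 4 := IsSieveComplete.isHereditarilyBaire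
  tfae_have 4 → 5 := countablyCompactSpace_of_isHereditarilyBaire
  tfae_have 5 → 1 := fun _ ↦ GraphSpace.isCompletelyMetrizableSpace
  tfae_finish
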